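/- Consider a finite system of sporadic tasks on one processor under preemptive fixed-priority scheduling, with pairwise distinct priorities. Task $\tau_i$ has worst-case execution time $C_i>0$, period (minimum time between two consecutive job releases) $T_i>0$, and an arbitrary relative deadline $D_i>0$; its utilization is $U_i=C_i/T_i$. Consecutive releases of $\tau_i$ are at least $T_i$ apart, every job of $\tau_i$ needs a positive amount of at most $C_i$ units of processor time, and the jobs of one task are executed in sequence. At every time the processor executes the pending job of highest priority (and idles only if no job is pending). The response time of a job is its finishing time minus its release time, and the worst-case response time $R_k$ of $\tau_k$ is the supremum of the response times of the jobs of $\tau_k$ over all legal job sequences and their schedules. Let $\tau_1,\dots,\tau_{k-1}$ be all the tasks with higher priority than $\tau_k$, indexed in a non-increasing order of their periods, $T_1\ge T_2\ge\dots\ge T_{k-1}$ (this order need not be the priority order). If $\sum_{i=1}^{k}U_i\le 1$, then $$R_k\;\le\;\frac{C_k+\sum_{i=1}^{k-1}C_i-\sum_{i=1}^{k-1}U_i\Big(\sum_{\ell=i}^{k-1}C_\ell\Big)}{1-\sum_{i=1}^{k-1}U_i}.$$ -/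

import Mathlib

open MeasureTheory

noncomputable section

/-- A sporadic real-time task: worst-case execution time, period (minimum inter-arrival time) and
relative deadline. The deadline is not related to the period (arbitrary deadlines). -/
structure SporadicTask where
  /-- worst-case execution time -/
  C : ℝ
  /-- period, i.e. minimum time between two consecutive releases -/
  T : ℝ
  /-- relative deadline -/
  D : ℝ
  C_pos : 0 < C
  T_pos : 0 < T
  D_pos : 0 < D

/-- The utilization `U = C / T` of a task. -/
def SporadicTask.U (a : SporadicTask) : ℝ := a.C / a.T

/-- A system of sporadic tasks with fixed, pairwise distinct priority levels;
a smaller number means a higher priority. -/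
structure TaskSystem (ι : Type*) where
  task : ι → SporadicTask
  prio : ι → ℕ
  prio_injective : Function.Injective prio

namespace TaskSystem

variable {ι : Type*}

/-- The set of the tasks that have higher priority than task `k`. -/
def hp (S : TaskSystem ι) (k : ι) : Set ι := {i | S.prio i < S.prio k}

/-- A legal job sequence of the task system: the `j`-th job of task `i` (numbered from `0`) is
released at time `release i j` and needs `exec i j` units of processor time. -/
structure Jobs (S : TaskSystem ι) where
  release : ι → ℕ → ℝ
  exec : ι → ℕ → ℝ
  release_add_le : ∀ i j, release i j + (S.task i).T ≤ release i (j + 1)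
  exec_pos : ∀ i j, 0 < exec i j
  exec_le : ∀ i j, exec i j ≤ (S.task i).C

variable {S : TaskSystem ι}

namespace Jobs

/-- The processor time that the `j`-th job of task `i` receives before time `t`, when the processor
executes the job `run s` (or idles, if `run s = none`) at each time `s`. -/
def service (J : S.Jobs) (run : ℝ → Option (ι × ℕ)) (i : ι) (j : ℕ) (t : ℝ) : ℝ :=
  volume.real {s | J.release i j ≤ s ∧ s < t ∧ run s = some (i, j)}

/-- At time `t` the `j`-th job of task `i` has been released and is not finished. -/
def Pending (J : S.Jobs) (run : ℝ → Option (ι × ℕ)) (i : ι) (j : ℕ) (t : ℝ) : Prop :=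
  J.release i j ≤ t ∧ J.service run i j t < J.exec i j

/-- `run` is the uniprocessor preemptive fixed-priority schedule of the job sequence: at each time
the processor executes the pending job of the highest priority, jobs of the same task being
executed in sequence (and it idles exactly if there is no such job). -/
structure IsFixedPrioritySchedule (J : S.Jobs) (run : ℝ → Option (ι × ℕ)) : Prop where
  measurableSet_run : ∀ i j, MeasurableSet {s | run s = some (i, j)}
  run_eq_some_iff : ∀ t i j, run t = some (i, j) ↔
    J.Pending run i j t ∧ (∀ j' < j, ¬ J.Pending run i j' t) ∧
      ∀ i' ∈ S.hp i, ∀ j', ¬ J.Pending run i' j' t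

/-- The time at which the `j`-th job of task `i` finishes (`⊤` if it never does). -/
def finishTime (J : S.Jobs) (run : ℝ → Option (ι × ℕ)) (i : ι) (j : ℕ) : EReal :=
  sInf {x | ∃ t : ℝ, x = (t : EReal) ∧ J.release i j ≤ t ∧ J.exec i j ≤ J.service run i j t}

/-- The response time of a job: its finishing time minus its release time. -/
def responseTime (J : S.Jobs) (run : ℝ → Option (ι × ℕ)) (i : ι) (j : ℕ) : EReal :=
  J.finishTime run i j - (J.release i j : EReal)

end Jobs

/-- The worst-case response time of task `k` under uniprocessor preemptive fixed-priority
scheduling: the supremum of the response times of its jobs, over all legal job sequences. -/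
def worstCaseResponseTime (S : TaskSystem ι) (k : ι) : EReal :=
  sSup {x | ∃ (J : S.Jobs) (run : ℝ → Option (ι × ℕ)) (j : ℕ),
    J.IsFixedPrioritySchedule run ∧ x = J.responseTime run k j}

end TaskSystem

end

/-! Let `t₀` start the level-`k` busy interval containing a time at which a job of `k` is pending.
Up to that time the elapsed time never exceeds the requested work (`exists_busy_interval`). Let `A`
be that work at length `x` minus one job per higher-priority task. Evaluating the request bound at
each task's last synchronous release `t j` and substituting into `A` yields a linear inequality for
`A`, with cross terms depending on the order of the `t j`. An exchange argument shows that ordering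
by period is the worst case. The `h` earlier jobs of `k` cost nothing: each adds `C` of work but
delays the release by `T`, and `U k ≤ 1 - ∑ U i`. -/

/-- The sum of `C j / T j * C i` over the ordered pairs with `t i < t j`, for any `t`, is at most
its sum over the pairs with `i < j`, if the indices are sorted by non-increasing `T`. -/
lemma sum_weighted_lt_le_sum_weighted_Iio {m : ℕ} {C T t : Fin m → ℝ} (hC : ∀ i, 0 < C i)
    (hT : ∀ i, 0 < T i) (hanti : Antitone T) :
    ∑ j, C j / T j * ∑ i, (if t i < t j then C i else 0) ≤
      ∑ j, C j / T j * ∑ i, (if i < j then C i else 0) := by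
  have hw : ∀ i j, 0 ≤ C j / T j * C i := fun i j ↦
    mul_nonneg (div_nonneg (hC j).le (hT j).le) (hC i).le
  have hcmp : ∀ i j, i ≤ j → C i / T i * C j ≤ C j / T j * C i := by
    intro i j hij
    have h1 : C i / T i * C j = C i * C j / T i := by ring
    have h2 : C j / T j * C i = C i * C j / T j := by ring
    rw [h1, h2]
    exact div_le_div_of_nonneg_left (mul_pos (hC i) (hC j)).le (hT j) (hanti hij)
  simp only [Finset.mul_sum, mul_ite, mul_zero]
  -- Symmetrizing allows a comparison pair by pair: at most one of `t i < t j`, `t j < t i` holds,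
  -- and the heavier weight divides by the shorter period, that of the larger index.
  have hsymm : ∀ F : Fin m → Fin m → ℝ,
      2 * ∑ j, ∑ i, F j i = ∑ j, ∑ i, (F j i + F i j) := by
    intro F
    simp only [Finset.sum_add_distrib]
    rw [Finset.sum_comm (f := fun j i ↦ F i j)]
    ring
  refine le_of_mul_le_mul_left ?_ (two_pos : (0 : ℝ) < 2)
  rw [hsymm, hsymm]
  refine Finset.sum_le_sum fun j _ ↦ Finset.sum_le_sum fun i _ ↦ ?_
  have hwij := hw i j
  have hwji := hw j i
  rcases lt_trichotomy i j with h | h | h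
  · have := hcmp i j h.le
    rw [if_pos h, if_neg h.not_gt]
    split_ifs <;> linarith
  · subst h
    simp
  · have := hcmp j i h.le
    rw [if_neg h.not_gt, if_pos h]
    split_ifs <;> linarith

/-- A quadratic bound on the length of an interval throughout which the request bound function
`H + ∑ ⌈y / T i⌉ * C i` is at least the elapsed time. -/
lemma mul_one_sub_le_of_le_requestBound {m : ℕ} {C T : Fin m → ℝ} {H x : ℝ}
    (hC : ∀ i, 0 < C i) (hT : ∀ i, 0 < T i) (hanti : Antitone T) (hU : ∑ i, C i / T i < 1)
    (hx : 0 ≤ x)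
    (hreq : ∀ y, 0 ≤ y → y ≤ x → y ≤ H + ∑ i, (⌈y / T i⌉₊ : ℝ) * C i) :
    x * (1 - ∑ i, C i / T i) ≤
      H + ∑ i, C i - ∑ i, C i / T i * ∑ l ∈ Finset.Ici i, C l := by
  -- For `x > 0`, `t i` is the last multiple of `T i` strictly before `x`; for `x = 0` truncated
  -- subtraction gives `0`.
  set n : Fin m → ℕ := fun i ↦ ⌈x / T i⌉₊ - 1 with hn
  set t : Fin m → ℝ := fun i ↦ n i * T i with ht
  set A : ℝ := H + ∑ i, C i / T i * t i with hA
  have hnC : ∀ i, C i / T i * t i = n i * C i := by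
    intro i
    have := (hT i).ne'
    simp only [ht]
    field_simp
  have hceil : ∀ i, ⌈x / T i⌉₊ ≤ n i + 1 := fun i ↦ by simp only [hn]; omega
  have htx : ∀ i, t i ≤ x := by
    intro i
    rcases Nat.eq_zero_or_pos (n i) with h | h
    · simp [ht, h, hx]
    · have h1 : n i < ⌈x / T i⌉₊ := by simp only [hn] at h ⊢; omega
      exact ((lt_div_iff₀ (hT i)).1 (Nat.lt_ceil.1 h1)).le
  have ht0 : ∀ i, 0 ≤ t i := fun i ↦ mul_nonneg (Nat.cast_nonneg _) (hT i).le
  -- By time `t j`, task `i` has requested its last job only if `t i < t j`.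
  have htj : ∀ j, t j ≤ A + ∑ i, (if t i < t j then C i else 0) := by
    intro j
    refine (hreq (t j) (ht0 j) (htx j)).trans ?_
    rw [hA, add_assoc, ← Finset.sum_add_distrib]
    gcongr with i
    rw [hnC]
    split_ifs with h
    · have h1 : ⌈t j / T i⌉₊ ≤ n i + 1 :=
        (Nat.ceil_mono (div_le_div_of_nonneg_right (htx j) (hT i).le)).trans (hceil i)
      have h2 : (⌈t j / T i⌉₊ : ℝ) ≤ n i + 1 := by exact_mod_cast h1
      nlinarith [hC i]
    · have h1 : ⌈t j / T i⌉₊ ≤ n i :=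
        Nat.ceil_le.2 ((div_le_iff₀ (hT i)).2 (not_lt.1 h))
      have h2 : (⌈t j / T i⌉₊ : ℝ) ≤ n i := by exact_mod_cast h1
      nlinarith [hC i]
  have hxA : x ≤ A + ∑ i, C i := by
    refine (hreq x hx le_rfl).trans ?_
    rw [hA, add_assoc, ← Finset.sum_add_distrib]
    gcongr with i
    rw [hnC]
    have h2 : (⌈x / T i⌉₊ : ℝ) ≤ n i + 1 := by exact_mod_cast hceil i
    nlinarith [hC i]
  have hA' : A ≤ H + ((∑ j, C j / T j) * A +
      ∑ j, C j / T j * ∑ i, (if i < j then C i else 0)) := by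
    calc A ≤ H + ∑ j, C j / T j * (A + ∑ i, (if t i < t j then C i else 0)) := by
          rw [hA]
          gcongr with j
          · exact div_nonneg (hC j).le (hT j).le
          · exact htj j
      _ = H + ((∑ j, C j / T j) * A +
            ∑ j, C j / T j * ∑ i, (if t i < t j then C i else 0)) := by
          rw [Finset.sum_mul, ← Finset.sum_add_distrib]
          simp only [mul_add]
      _ ≤ _ := by
          gcongr H + (_ + ?_)
          exact sum_weighted_lt_le_sum_weighted_Iio hC hT hanti
  have hsplit : ∑ j, C j / T j * ∑ i, (if i < j then C i else 0) =
      (∑ j, C j / T j) * ∑ i, C i - ∑ i, C i / T i * ∑ l ∈ Finset.Ici i, C l := by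
    rw [Finset.sum_mul, ← Finset.sum_sub_distrib]
    refine Finset.sum_congr rfl fun j _ ↦ ?_
    rw [← mul_sub]
    congr 1
    rw [eq_sub_iff_add_eq, ← Finset.sum_filter,
      ← Finset.sum_filter_add_sum_filter_not Finset.univ (fun i ↦ i < j)]
    congr 2
    ext i
    simp
  nlinarith [mul_le_mul_of_nonneg_right hxA (sub_pos.2 hU).le]

/-! ### Release sequences, service and busy intervals. -/

/-- A sequence whose increments are at least `T > 0` has a first term at or after any time `t₀`,
and grows at least linearly from there. -/
lemma exists_forall_lt_and_add_mul_le {f : ℕ → ℝ} {T : ℝ} (hT : 0 < T)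
    (hf : ∀ j, f j + T ≤ f (j + 1)) (t₀ : ℝ) :
    ∃ a, (∀ j < a, f j < t₀) ∧ ∀ n : ℕ, t₀ + n * T ≤ f (a + n) := by
  have hgrow : ∀ a n : ℕ, f a + n * T ≤ f (a + n) := by
    intro a n
    induction n with
    | zero => simp
    | succ n ih =>
      have := hf (a + n)
      rw [← add_assoc]
      push_cast
      linarith
  have hex : ∃ j, t₀ ≤ f j := by
    obtain ⟨n, hn⟩ := Archimedean.arch (t₀ - f 0) hT
    refine ⟨n, ?_⟩
    have := hgrow 0 n
    rw [nsmul_eq_mul] at hn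
    rw [zero_add] at this
    linarith
  classical
  refine ⟨Nat.find hex, fun j hj ↦ not_le.1 (Nat.find_min hex hj), fun n ↦ ?_⟩
  have := Nat.find_spec hex
  have := hgrow (Nat.find hex) n
  linarith

namespace TaskSystem.Jobs

variable {ι : Type*} {S : TaskSystem ι} {J : S.Jobs} {run : ℝ → Option (ι × ℕ)}

lemma strictMono_release (J : S.Jobs) (i : ι) : StrictMono (J.release i) :=
  strictMono_nat_of_lt_succ fun j ↦ by
    linarith [J.release_add_le i j, (S.task i).T_pos]

lemma volume_serviceSet_ne_top (i : ι) (j : ℕ) (t : ℝ) :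
    volume {s | J.release i j ≤ s ∧ s < t ∧ run s = some (i, j)} ≠ ⊤ :=
  ((measure_mono (t := Set.Ico (J.release i j) t) fun _ hs ↦ ⟨hs.1, hs.2.1⟩).trans_lt
    (by simp)).ne

lemma service_mono (i : ι) (j : ℕ) : Monotone (J.service run i j) := fun _ t hst ↦
  measureReal_mono (fun _ hu ↦ ⟨hu.1, hu.2.1.trans_le hst, hu.2.2⟩)
    (volume_serviceSet_ne_top i j t)

lemma service_eq_zero {i : ι} {j : ℕ} {t : ℝ} (h : t ≤ J.release i j) :
    J.service run i j t = 0 := by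
  have : {s | J.release i j ≤ s ∧ s < t ∧ run s = some (i, j)} = ∅ := by
    ext s
    simp only [Set.mem_ofPred_eq, Set.mem_empty_iff_false, iff_false]
    rintro ⟨h1, h2, -⟩
    linarith
  simp [service, this]

/-- A fixed-priority schedule gives no job more processor time than it needs. -/
lemma service_le_exec (h : J.IsFixedPrioritySchedule run) (i : ι) (j : ℕ) (t : ℝ) :
    J.service run i j t ≤ J.exec i j := by
  set E := {s | J.release i j ≤ s ∧ s < t ∧ run s = some (i, j)} with hE
  rcases E.eq_empty_or_nonempty with h0 | hne
  · have : J.service run i j t = 0 := by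
      change volume.real E = 0
      simp [h0]
    rw [this]
    exact (J.exec_pos i j).le
  have hbdd : BddAbove E := ⟨t, fun s hs ↦ hs.2.1.le⟩
  refine le_of_forall_pos_le_add fun ε hε ↦ ?_
  -- The job is still pending at `s`, and less than `ε` of its service can come later.
  obtain ⟨s, hs, hsε⟩ := exists_lt_of_lt_csSup hne (sub_lt_self (sSup E) hε)
  have hsub : E ⊆ {u | J.release i j ≤ u ∧ u < s ∧ run u = some (i, j)} ∪ Set.Icc s (sSup E) := by
    intro u hu
    rcases lt_or_ge u s with h1 | h1
    · exact Or.inl ⟨hu.1, h1, hu.2.2⟩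
    · exact Or.inr ⟨h1, le_csSup hbdd hu⟩
  have hs_le : s ≤ sSup E := le_csSup hbdd hs
  calc volume.real E
      ≤ volume.real ({u | J.release i j ≤ u ∧ u < s ∧ run u = some (i, j)} ∪
          Set.Icc s (sSup E)) :=
        measureReal_mono hsub
          (measure_union_ne_top (volume_serviceSet_ne_top i j s) (by simp))
    _ ≤ J.service run i j s + volume.real (Set.Icc s (sSup E)) := measureReal_union_le _ _
    _ ≤ J.exec i j + ε := by
        rw [Real.volume_real_Icc_of_le hs_le]
        have := ((h.run_eq_some_iff s i j).1 hs.2.2).1.2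
        linarith

/-- Whenever a job of `k` or of a task of higher priority is pending, the processor executes such
a job. -/
lemma exists_run_eq_some (h : J.IsFixedPrioritySchedule run) {k : ι} {t : ℝ}
    (hp : ∃ i j, S.prio i ≤ S.prio k ∧ J.Pending run i j t) :
    ∃ i j, S.prio i ≤ S.prio k ∧ run t = some (i, j) := by
  classical
  have hp' : ∃ p, ∃ i j, S.prio i = p ∧ J.Pending run i j t := by
    obtain ⟨i, j, -, hij⟩ := hp
    exact ⟨_, i, j, rfl, hij⟩
  obtain ⟨i, j, hi, hij⟩ := Nat.find_spec hp'
  have hj : ∃ j, J.Pending run i j t := ⟨j, hij⟩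
  refine ⟨i, Nat.find hj, ?_, (h.run_eq_some_iff _ _ _).2
    ⟨Nat.find_spec hj, fun j' hj' ↦ Nat.find_min hj hj', fun i' hi' j' hp'' ↦ ?_⟩⟩
  · obtain ⟨i₁, j₁, h₁, h₁'⟩ := hp
    rw [hi]
    exact (Nat.find_min' hp' ⟨i₁, j₁, rfl, h₁'⟩).trans h₁
  · have : S.prio i' < S.prio i := hi'
    rw [hi] at this
    exact Nat.find_min hp' this ⟨i', j', rfl, hp''⟩

/-- The start of the busy interval of level `k` that contains the time `t`: every job of level `k`
released before it is finished by then, and afterwards, until `t`, a job of level `k` is always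
pending. -/
lemma exists_busy_start [Finite ι] (J : S.Jobs) (run : ℝ → Option (ι × ℕ)) (k : ι) (t : ℝ) :
    ∃ t₀ ≤ t, (∀ i j, S.prio i ≤ S.prio k → J.release i j < t₀ →
        J.exec i j ≤ J.service run i j t₀) ∧
      ∀ s, t₀ < s → s ≤ t → ∃ i j, S.prio i ≤ S.prio k ∧ J.Pending run i j s := by
  set Q := {s | s ≤ t ∧ ∀ i j, S.prio i ≤ S.prio k → J.release i j < s →
    J.exec i j ≤ J.service run i j s} with hQ
  have hne : Q.Nonempty := by
    -- Finitely many tasks: before some time `b` nothing has been released.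
    obtain ⟨b, hb⟩ := (Set.finite_range fun i ↦ J.release i 0).bddBelow
    refine ⟨min t b, min_le_left _ _, fun i j _ hlt ↦ ?_⟩
    have h1 : b ≤ J.release i 0 := hb ⟨i, rfl⟩
    have h2 := (J.strictMono_release i).monotone (Nat.zero_le j)
    have h3 := min_le_right t b
    linarith
  have hbdd : BddAbove Q := ⟨t, fun s hs ↦ hs.1⟩
  refine ⟨sSup Q, csSup_le hne fun s hs ↦ hs.1, fun i j hi hlt ↦ ?_, fun s hs hst ↦ ?_⟩
  · obtain ⟨s, hs, hlt'⟩ := exists_lt_of_lt_csSup hne hlt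
    exact (hs.2 i j hi hlt').trans (service_mono i j (le_csSup hbdd hs))
  · by_contra! hcon
    refine (le_csSup hbdd (a := s) ⟨hst, fun i j hi hlt ↦ ?_⟩).not_gt hs
    by_contra! hlt'
    exact hcon i j hi ⟨hlt.le, hlt'⟩

/-- If the `j`-th job of task `k` is pending at time `t`, the time elapsed since the start `t₀` of
the busy interval never exceeds the work requested by the `h` jobs of `k` up to this one and by the
tasks of higher priority. -/
lemma exists_busy_interval [Finite ι] (hrun : J.IsFixedPrioritySchedule run) {k : ι} {j : ℕ}
    {t : ℝ} (hp : J.Pending run k j t) {m : ℕ} (e : Fin m ≃ S.hp k) :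
    ∃ (t₀ : ℝ) (h : ℕ), t₀ ≤ t ∧ t₀ + h * (S.task k).T ≤ J.release k j ∧
      ∀ y, 0 ≤ y → y ≤ t - t₀ → y ≤ (h + 1) * (S.task k).C +
        ∑ a, (⌈y / (S.task (e a)).T⌉₊ : ℝ) * (S.task (e a)).C := by
  classical
  obtain ⟨t₀, ht₀, hdone, hbusy⟩ := exists_busy_start J run k t
  choose a ha_lt ha_le using fun i ↦
    exists_forall_lt_and_add_mul_le (S.task i).T_pos (J.release_add_le i) t₀
  have hlej : t₀ ≤ J.release k j := by
    by_contra! hlt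
    exact hp.2.not_ge ((hdone k j le_rfl hlt).trans (service_mono k j ht₀))
  have haj : a k ≤ j := by
    by_contra! hlt
    exact (ha_lt k j hlt).not_ge hlej
  refine ⟨t₀, j - a k, ht₀, ?_, fun y hy hyt ↦ ?_⟩
  · have := ha_le k (j - a k)
    rwa [Nat.add_sub_cancel' haj] at this
  set N : Fin m → ℕ := fun b ↦ ⌈y / (S.task (e b)).T⌉₊ with hN
  set W : ι → ℕ → Set ℝ := fun i l ↦
    {s | J.release i l ≤ s ∧ s < t₀ + y ∧ run s = some (i, l)} with hW
  have hWle : ∀ i l, volume.real (W i l) ≤ (S.task i).C := fun i l ↦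
    (service_le_exec hrun i l (t₀ + y)).trans (J.exec_le i l)
  have hWtop : ∀ i l, volume (W i l) ≠ ⊤ := fun i l ↦ volume_serviceSet_ne_top i l (t₀ + y)
  have hcover : Set.Ioo t₀ (t₀ + y) ⊆
      (⋃ n ∈ Finset.range (j - a k + 1), W k (a k + n)) ∪
        ⋃ b ∈ (Finset.univ : Finset (Fin m)), ⋃ n ∈ Finset.range (N b), W (e b) (a (e b) + n) := by
    rintro s ⟨hs0, hsy⟩
    obtain ⟨i, l, hi, hil⟩ := exists_run_eq_some hrun (hbusy s hs0 (by linarith))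
    obtain ⟨hpend, hfirst, -⟩ := (hrun.run_eq_some_iff s i l).1 hil
    have hal : a i ≤ l := by
      by_contra! hlt
      exact hpend.2.not_ge ((hdone i l hi (ha_lt i l hlt)).trans (service_mono i l hs0.le))
    obtain ⟨n, rfl⟩ := Nat.exists_eq_add_of_le hal
    have hsW : s ∈ W i (a i + n) := ⟨hpend.1, hsy, hil⟩
    rcases hi.lt_or_eq with hlt | heq
    · right
      obtain ⟨b, hb⟩ := e.surjective ⟨i, hlt⟩
      obtain rfl : (e b : ι) = i := by rw [hb]
      simp only [Set.mem_iUnion]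
      refine ⟨b, Finset.mem_univ b, n, Finset.mem_range.2 (Nat.lt_ceil.2 ?_), hsW⟩
      rw [lt_div_iff₀ (S.task (e b)).T_pos]
      have := ha_le (e b) n
      have := hpend.1
      linarith
    · left
      obtain rfl := S.prio_injective heq
      simp only [Set.mem_iUnion]
      refine ⟨n, Finset.mem_range.2 ?_, hsW⟩
      -- A job of `k` after the `j`-th cannot run yet, since the `j`-th is pending up to `t`.
      by_contra! hn
      have hjlt : j < a i + n := by omega
      have hrel := J.strictMono_release i hjlt
      refine hfirst j hjlt ⟨hrel.le.trans hpend.1, (service_mono i j ?_).trans_lt hp.2⟩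
      linarith
  have hk_le : volume.real (⋃ n ∈ Finset.range (j - a k + 1), W k (a k + n)) ≤
      ((j - a k : ℕ) + 1) * (S.task k).C := by
    refine (measureReal_biUnion_finset_le _ _).trans
      ((Finset.sum_le_sum fun n _ ↦ hWle k (a k + n)).trans ?_)
    simp
  have hb_le : ∀ b, volume.real (⋃ n ∈ Finset.range (N b), W (e b) (a (e b) + n)) ≤
      N b * (S.task (e b)).C := fun b ↦ by
    refine (measureReal_biUnion_finset_le _ _).trans
      ((Finset.sum_le_sum fun n _ ↦ hWle (e b) (a (e b) + n)).trans ?_)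
    simp
  calc y = volume.real (Set.Ioo t₀ (t₀ + y)) := by
        rw [Real.volume_real_Ioo_of_le (by linarith)]
        ring
    _ ≤ _ := measureReal_mono hcover (measure_union_ne_top
        (measure_biUnion_lt_top (Finset.finite_toSet _) fun n _ ↦ (hWtop _ _).lt_top).ne
        (measure_biUnion_lt_top (Finset.finite_toSet _) fun b _ ↦
          measure_biUnion_lt_top (Finset.finite_toSet _) fun n _ ↦ (hWtop _ _).lt_top).ne)
    _ ≤ _ := measureReal_union_le _ _
    _ ≤ _ := add_le_add hk_le ((measureReal_biUnion_finset_le _ _).trans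
        (Finset.sum_le_sum fun b _ ↦ hb_le b))

/-- If no job is pending later than `R` after its release, then `R` bounds the response time. -/
lemma responseTime_le {i : ι} {j : ℕ} {R : ℝ}
    (h : ∀ t, J.Pending run i j t → t - J.release i j ≤ R) :
    J.responseTime run i j ≤ R := by
  have hR : 0 ≤ R := by
    have := h (J.release i j) ⟨le_rfl, by rw [service_eq_zero le_rfl]; exact J.exec_pos i j⟩
    simpa using this
  have hfin : J.finishTime run i j ≤ ((R + J.release i j : ℝ) : EReal) := by
    -- The job may still be pending exactly at `R` after its release, hence the strictly later `z`.
    refine EReal.le_of_forall_lt_iff_le.1 fun z hz ↦ ?_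
    have hz' : R + J.release i j < z := by exact_mod_cast hz
    refine sInf_le ⟨z, rfl, by linarith, ?_⟩
    by_contra! hlt
    have := h z ⟨by linarith, hlt⟩
    linarith
  refine EReal.sub_le_of_le_add ?_
  rwa [← EReal.coe_add]

end TaskSystem.Jobs

open TaskSystem.Jobs in
theorem mainTheorem1 {ι : Type*} [Finite ι] (S : TaskSystem ι) (k : ι)
    -- an enumeration of the higher-priority tasks in a non-increasing order of their periods
    (m : ℕ) (e : Fin m ≃ S.hp k)
    (he : ∀ a b : Fin m, a ≤ b → (S.task (e b)).T ≤ (S.task (e a)).T)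
    (hU : ∑ a, (S.task (e a)).U + (S.task k).U ≤ 1) :
    S.worstCaseResponseTime k ≤
      ((((S.task k).C + ∑ a, (S.task (e a)).C
          - ∑ a, (S.task (e a)).U * ∑ b ∈ Finset.Ici a, (S.task (e b)).C)
        / (1 - ∑ a, (S.task (e a)).U) : ℝ) : EReal) := by
  refine sSup_le ?_
  rintro _ ⟨J, run, j, hrun, rfl⟩
  refine responseTime_le fun t hp ↦ ?_
  obtain ⟨t₀, h, ht₀, hrel, hreq⟩ := exists_busy_interval hrun hp e
  have hUk : 0 < (S.task k).U := div_pos (S.task k).C_pos (S.task k).T_pos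
  have hU1 : ∑ a, (S.task (e a)).U < 1 := by linarith
  have hlen := mul_one_sub_le_of_le_requestBound (C := fun a ↦ (S.task (e a)).C)
    (T := fun a ↦ (S.task (e a)).T) (fun a ↦ (S.task (e a)).C_pos)
    (fun a ↦ (S.task (e a)).T_pos) he hU1
    (sub_nonneg.2 ht₀) hreq
  rw [le_div_iff₀ (by linarith)]
  -- Multiplied by `h`, this absorbs the work of the earlier jobs of `k`.
  have hC : (S.task k).C ≤ (1 - ∑ a, (S.task (e a)).U) * (S.task k).T := by
    rw [← div_le_iff₀ (S.task k).T_pos]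
    change (S.task k).U ≤ _
    linarith
  have hhC := mul_le_mul_of_nonneg_left hC (Nat.cast_nonneg (α := ℝ) h)
  have hmul := mul_le_mul_of_nonneg_right hrel (sub_pos.2 hU1).le
  change (t - t₀) * (1 - ∑ a, (S.task (e a)).U) ≤ (h + 1) * (S.task k).C +
    ∑ a, (S.task (e a)).C - ∑ a, (S.task (e a)).U * ∑ b ∈ Finset.Ici a, (S.task (e b)).C at hlen
  nlinarith
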